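/- Let $K<p$ be integers with $K\ge 0$, let $N=2p-1$, and write $[Z]=\{ZO : O\in\mathbb{R}^{K\times K},\ OO^\top=O^\top O=I_K\}$ for a matrix $Z\in\mathbb{C}^{p\times K}$ of rank $K$ (every $ZO$ again has rank $K$). Let $x\in\mathbb{C}^N$ be given by $$x_n=\sum_{k=1}^K s_k\,e^{2\pi i (n-1) f_k},\qquad n=1,\dots,N,$$ with nonzero coefficients $s_1,\dots,s_K\in\mathbb{C}$ and frequencies $f_1,\dots,f_K\in\mathbb{R}$ that are pairwise distinct modulo $1$. Let $\mathcal{H}x$ be the $p\times p$ Hankel matrix with $(i_1,i_2)$ entry $x_{i_1+i_2-1}$. Then among the equivalence classes $[Z]$, where $Z$ ranges over the complex $p\times K$ matrices of rank $K$, there is exactly one all of whose representatives $Z$ satisfy $$\mathcal{H}x=ZZ^\top\quad\text{and}\quad ZZ^H\ \text{is a Toeplitz matrix.}$$ It is the class $[A(f)\,\mathrm{diag}(s)^{1/2}]$, where $A(f)$ is the $p\times K$ matrix with $(m,k)$ entry $e^{2\pi i (m-1) f_k}$ and $\mathrm{diag}(s)^{1/2}=\mathrm{diag}(r_1,\dots,r_K)$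 for any choice of complex square roots $r_k^2=s_k$; in particular this matrix has rank $K$. -/

import Mathlib

open scoped Matrix

noncomputable section

namespace SpectralSparse

/-- `x` is a spectral-sparse signal of length `2p - 1` with frequency vector `f` and coefficient
vector `s`: the coefficients are nonzero, the frequencies are distinct as frequencies, that is,
modulo `1`, and `x n = ∑ k, s k * exp (2 π i n f k)` (samples indexed from `n = 0`). -/
def HasSpectrum {p K : ℕ} (x : Fin (2 * p - 1) → ℂ) (f : Fin K → ℝ) (s : Fin K → ℂ) : Prop :=
  (∀ k, s k ≠ 0) ∧
  (∀ k₁ k₂, k₁ ≠ k₂ → (f k₁ : UnitAddCircle) ≠ (f k₂ : UnitAddCircle)) ∧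
  ∀ n, x n = ∑ k, s k * Complex.exp (2 * Real.pi * Complex.I * ((n : ℕ) : ℂ) * (f k : ℂ))

/-- The `p × p` Hankel matrix of `x`; with indices from `0`, its `(i, j)` entry is `x (i + j)`. -/
def hankel {p : ℕ} (x : Fin (2 * p - 1) → ℂ) : Matrix (Fin p) (Fin p) ℂ :=
  Matrix.of fun i j => x ⟨(i : ℕ) + (j : ℕ), by omega⟩

/-- The `p × p` Toeplitz matrix of `t`; with indices from `0`, its `(i, j)` entry is
`t (i - j + (p - 1))`. -/
def toeplitz {p : ℕ} (t : Fin (2 * p - 1) → ℂ) : Matrix (Fin p) (Fin p) ℂ :=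
  Matrix.of fun i j => t ⟨(i : ℕ) + (p - 1 - (j : ℕ)), by omega⟩

/-- A matrix is Toeplitz if it is the Toeplitz matrix of some vector. -/
def IsToeplitz {p : ℕ} (M : Matrix (Fin p) (Fin p) ℂ) : Prop :=
  ∃ t : Fin (2 * p - 1) → ℂ, M = toeplitz t

/-- The complex `p × K` matrices of rank `K`. -/
def fullRank (p K : ℕ) : Set (Matrix (Fin p) (Fin K) ℂ) :=
  {Z | Z.rank = K}

/-- The class `[Z] = {Z O of rank K : O a real orthogonal K × K matrix}`. -/
def eqClass {p K : ℕ} (Z : Matrix (Fin p) (Fin K) ℂ) : Set (Matrix (Fin p) (Fin K) ℂ) :=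
  {W | W ∈ fullRank p K ∧
    ∃ O ∈ Matrix.orthogonalGroup (Fin K) ℝ, W = Z * O.map (fun a : ℝ => (a : ℂ))}

/-- The set of all equivalence classes `[Z]`, where `Z` has rank `K`. -/
def quotientSet (p K : ℕ) : Set (Set (Matrix (Fin p) (Fin K) ℂ)) :=
  {C | ∃ Z ∈ fullRank p K, C = eqClass Z}

/-- The `p × K` Vandermonde matrix `A(f)` with entries `exp (2 π i m f k)`, `0 ≤ m < p`. -/
def vandermonde (p : ℕ) {K : ℕ} (f : Fin K → ℝ) : Matrix (Fin p) (Fin K) ℂ :=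
  Matrix.of fun m k => Complex.exp (2 * Real.pi * Complex.I * ((m : ℕ) : ℂ) * (f k : ℂ))

/-- Every representative `Z` of the class `C` satisfies `H x = Z Zᵀ`, and `Z Zᴴ` is Toeplitz. -/
def Represents {p K : ℕ} (C : Set (Matrix (Fin p) (Fin K) ℂ)) (x : Fin (2 * p - 1) → ℂ) : Prop :=
  ∀ Z ∈ C, hankel x = Z * Zᵀ ∧ IsToeplitz (Z * Zᴴ)

end SpectralSparse

end

namespace SpectralSparse

open Matrix

/-! ### Full column rank as left invertibility -/

section LeftInverse

variable {p K : ℕ}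

/-! Write `A` for the Vandermonde matrix of the nodes, so `H x = A diag(s) Aᵀ`. The factor `A
diag(r)` works because the nodes are unimodular. Conversely, if `H x = Z Zᵀ` with `Z` of full column
rank, then `Z = A diag(r) O` with `O Oᵀ = 1`. The Toeplitz condition makes `O Oᴴ` diagonal
(`isDiag_of_isToeplitz`), and this forces `O` to be real (`exists_real_orthogonal`), so `Z` lies in
the class of `A diag(r)`. -/

theorem exists_left_inverse_of_mulVec_injective {M : Matrix (Fin p) (Fin K) ℂ}
    (hM : ∀ v, M *ᵥ v = 0 → v = 0) : ∃ L : Matrix (Fin K) (Fin p) ℂ, L * M = 1 := by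
  obtain ⟨g, hg⟩ := LinearMap.exists_leftInverse_of_injective M.toLin'
    (LinearMap.ker_eq_bot'.2 hM)
  refine ⟨LinearMap.toMatrix' g, ?_⟩
  have h := congrArg LinearMap.toMatrix' hg
  rwa [LinearMap.toMatrix'_comp, LinearMap.toMatrix'_toLin', LinearMap.toMatrix'_id] at h

theorem mem_fullRank_iff_exists_left_inverse {M : Matrix (Fin p) (Fin K) ℂ} :
    M ∈ fullRank p K ↔ ∃ L : Matrix (Fin K) (Fin p) ℂ, L * M = 1 := by
  constructor
  · intro h
    have h1 := LinearMap.finrank_range_add_finrank_ker M.mulVecLin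
    have h2 : Module.finrank ℂ (LinearMap.range M.mulVecLin) = K := h
    rw [h2, Module.finrank_fin_fun] at h1
    have h3 : Module.finrank ℂ (LinearMap.ker M.mulVecLin) = 0 := by omega
    exact exists_left_inverse_of_mulVec_injective
      (LinearMap.ker_eq_bot'.1 (Submodule.finrank_eq_zero.1 h3))
  · rintro ⟨L, hL⟩
    refine le_antisymm M.rank_le_width ?_
    calc K = (L * M).rank := by rw [hL, rank_one, Fintype.card_fin]
      _ ≤ M.rank := rank_mul_le_right L M

theorem eq_of_mul_mul_eq_mul_mul {A : Matrix (Fin p) (Fin K) ℂ} {B : Matrix (Fin K) (Fin p) ℂ}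
    {L : Matrix (Fin K) (Fin p) ℂ} {R : Matrix (Fin p) (Fin K) ℂ} (hL : L * A = 1)
    (hR : B * R = 1) {P Q : Matrix (Fin K) (Fin K) ℂ} (h : A * P * B = A * Q * B) : P = Q := by
  have key : ∀ X : Matrix (Fin K) (Fin K) ℂ, L * (A * X * B) * R = X := fun X => by
    calc L * (A * X * B) * R = (L * A) * X * (B * R) := by simp only [Matrix.mul_assoc]
      _ = X := by rw [hL, hR, Matrix.one_mul, Matrix.mul_one]
  rw [← key P, h, key Q]

end LeftInverse

/-! ### Vandermonde factorizations of Hankel and Toeplitz matrices -/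

/-- The `n × K` matrix with entries `z k ^ m`. -/
def powers (n : ℕ) {K : ℕ} (z : Fin K → ℂ) : Matrix (Fin n) (Fin K) ℂ :=
  of fun m k => z k ^ (m : ℕ)

theorem exists_left_inverse_powers {n K : ℕ} (hK : K ≤ n) {z : Fin K → ℂ}
    (hz : Function.Injective z) : ∃ L : Matrix (Fin K) (Fin n) ℂ, L * powers n z = 1 := by
  refine exists_left_inverse_of_mulVec_injective fun v hv => ?_
  refine eq_zero_of_forall_pow_sum_mul_pow_eq_zero hz fun i => ?_
  have h := congrFun hv (Fin.castLE hK i)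
  simpa [mulVec, dotProduct, powers, mul_comm] using h

theorem powers_mul_diagonal_mul_transpose {p K : ℕ} {x : Fin (2 * p - 1) → ℂ} {z s : Fin K → ℂ}
    (hx : ∀ n, x n = ∑ k, s k * z k ^ (n : ℕ)) :
    hankel x = powers p z * diagonal s * (powers p z)ᵀ := by
  ext i j
  rw [mul_apply]
  simp only [hankel, of_apply, hx, mul_diagonal, transpose_apply, powers]
  exact Finset.sum_congr rfl fun k _ => by rw [pow_add]; ring

theorem isToeplitz_powers_mul_diagonal {p K : ℕ} {z : Fin K → ℂ} (hz : ∀ k, z k * star (z k) = 1)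
    (d : Fin K → ℂ) : IsToeplitz (powers p z * diagonal d * (powers p z)ᴴ) := by
  -- On the unit circle `star z ^ (p - 1)` is `z ^ (-(p - 1))`, which turns the offset index `i + (p
  -- - 1 - j)` into the exponent `i - j`.
  refine ⟨fun q => ∑ k, d k * (z k ^ (q : ℕ) * star (z k) ^ (p - 1)), ?_⟩
  ext i j
  rw [mul_apply]
  simp only [toeplitz, of_apply, mul_diagonal, conjTranspose_apply, powers, star_pow]
  refine Finset.sum_congr rfl fun k _ => ?_
  have hj : p - 1 = (p - 1 - (j : ℕ)) + j := by omega
  have h1 : z k ^ (p - 1 - (j : ℕ)) * star (z k) ^ (p - 1 - (j : ℕ)) = 1 := by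
    rw [← mul_pow, hz, one_pow]
  conv_rhs => rw [hj, pow_add (star (z k)), ← hj, pow_add]
  linear_combination (-(z k ^ (i : ℕ) * d k * star (z k) ^ (j : ℕ))) * h1

theorem IsToeplitz.apply_succ_succ {q : ℕ} {M : Matrix (Fin (q + 1)) (Fin (q + 1)) ℂ}
    (hM : IsToeplitz M) (i j : Fin q) : M i.succ j.succ = M i.castSucc j.castSucc := by
  obtain ⟨t, rfl⟩ := hM
  simp only [toeplitz, of_apply]
  congr 1
  ext
  simp only [Fin.val_succ, Fin.val_castSucc]
  omega

/-- Shift invariance: the two `q × q` corner blocks of a Toeplitz matrix agree, and moving from one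
to the other replaces `P` by `D P Dᴴ` with `D = diag(z)`. Since `K ≤ q`, the truncated Vandermonde
factors cancel, so `P k l` is fixed by multiplication by `z k * star (z l)`, which is not `1` off
the diagonal. -/
theorem isDiag_of_isToeplitz {q K : ℕ} (hK : K ≤ q) {z : Fin K → ℂ} (hinj : Function.Injective z)
    (hz : ∀ k, z k * star (z k) = 1) {P : Matrix (Fin K) (Fin K) ℂ}
    (hP : IsToeplitz (powers (q + 1) z * P * (powers (q + 1) z)ᴴ)) {k l : Fin K} (hkl : k ≠ l) :
    P k l = 0 := by
  obtain ⟨L, hL⟩ := exists_left_inverse_powers hK hinj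
  have hR : (powers q z)ᴴ * Lᴴ = 1 := by
    rw [← conjTranspose_mul, hL, conjTranspose_one]
  have h : powers q z * (diagonal z * P * (diagonal z)ᴴ) * (powers q z)ᴴ
      = powers q z * P * (powers q z)ᴴ := by
    ext i j
    have h1 := hP.apply_succ_succ i j
    have hs : ∀ i k, powers (q + 1) z (Fin.succ i) k = (powers q z * diagonal z) i k := by
      intro i k
      simp [powers, mul_diagonal, pow_succ]
    calc _ = ((powers q z * diagonal z) * P * (powers q z * diagonal z)ᴴ) i j := by
          rw [conjTranspose_mul]; simp only [Matrix.mul_assoc]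
      _ = (powers (q + 1) z * P * (powers (q + 1) z)ᴴ) i.succ j.succ := by
          simp only [mul_apply (N := (powers q z * diagonal z)ᴴ),
            mul_apply (N := (powers (q + 1) z)ᴴ), mul_apply (N := P), conjTranspose_apply, hs]
      _ = _ := h1
      _ = _ := by simp [mul_apply, powers]
  have h2 := congrFun (congrFun (eq_of_mul_mul_eq_mul_mul hL hR h) k) l
  rw [diagonal_conjTranspose, mul_diagonal, diagonal_mul, Pi.star_apply] at h2
  have hne : z k * star (z l) ≠ 1 := fun h3 => hkl <| hinj <| by
    linear_combination (-z k) * hz l + z l * h3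
  have h4 : P k l * (z k * star (z l) - 1) = 0 := by linear_combination h2
  exact (mul_eq_zero.1 h4).resolve_right (sub_ne_zero.2 hne)

/-- A complex orthogonal matrix with pairwise orthogonal rows is real. -/
theorem exists_real_orthogonal {K : ℕ} {O : Matrix (Fin K) (Fin K) ℂ} (hO : O * Oᵀ = 1)
    (hdiag : ∀ k l, k ≠ l → (O * Oᴴ) k l = 0) :
    ∃ U ∈ orthogonalGroup (Fin K) ℝ, O = U.map (fun a : ℝ => (a : ℂ)) := by
  set e : Fin K → ℝ := fun k => ∑ j, ‖O k j‖ ^ 2 with he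
  have hE : O * Oᴴ = diagonal (fun k => (e k : ℂ)) := by
    ext k l
    by_cases hkl : k = l
    · subst hkl
      rw [diagonal_apply_eq, mul_apply, he, Complex.ofReal_sum]
      refine Finset.sum_congr rfl fun j _ => ?_
      rw [conjTranspose_apply, Complex.ofReal_pow]
      exact Complex.mul_conj' _
    · rw [hdiag k l hkl, diagonal_apply_ne _ hkl]
  have hO' : Oᵀ * O = 1 := mul_eq_one_comm.1 hO
  have hconj : Oᴴ * (Oᵀ)ᴴ = 1 := by rw [← conjTranspose_mul, hO', conjTranspose_one]
  -- `(Oᵀ)ᴴ` is the entrywise conjugate of `O`. Comparing moduli at a nonzero entry of each row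
  -- gives `e k = 1`, so `O` equals its conjugate.
  have h1 : O = diagonal (fun k => (e k : ℂ)) * (Oᵀ)ᴴ := by
    rw [← hE, Matrix.mul_assoc, hconj, Matrix.mul_one]
  have h2 : ∀ k j, O k j = (e k : ℂ) * star (O k j) := fun k j => by
    have := congrFun (congrFun h1 k) j
    rwa [diagonal_mul] at this
  have he1 : ∀ k, e k = 1 := fun k => by
    have hne : ∃ j, O k j ≠ 0 := by
      by_contra! hcon
      have := congrFun (congrFun hO k) k
      simp [mul_apply, hcon] at this
    obtain ⟨j, hj⟩ := hne
    have h3 := congrArg norm (h2 k j)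
    rw [norm_mul, norm_star, Complex.norm_real, Real.norm_of_nonneg
      (Finset.sum_nonneg fun j _ => sq_nonneg ‖O k j‖)] at h3
    exact (mul_right_cancel₀ (norm_ne_zero_iff.2 hj) (by rw [one_mul]; exact h3)).symm
  have hre : O = (O.map Complex.re).map (fun a : ℝ => (a : ℂ)) := by
    ext k j
    have h3 := h2 k j
    rw [he1, Complex.ofReal_one, one_mul] at h3
    exact (Complex.conj_eq_iff_re.1 h3.symm).symm
  refine ⟨O.map Complex.re, ?_, hre⟩
  rw [mem_orthogonalGroup_iff]
  apply map_injective Complex.ofReal_injective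
  change (O.map Complex.re * (O.map Complex.re)ᵀ).map Complex.ofRealHom
    = (1 : Matrix _ _ ℝ).map Complex.ofRealHom
  rw [Matrix.map_mul, ← transpose_map]
  change (O.map Complex.re).map (fun a : ℝ => (a : ℂ))
    * ((O.map Complex.re).map (fun a : ℝ => (a : ℂ)))ᵀ = _
  rw [← hre, hO, Matrix.map_one _ (map_zero _) (map_one _)]

/-! ### Invariance under real orthogonal factors -/

section Classes

variable {p K : ℕ}

theorem map_ofReal_mul_transpose {O : Matrix (Fin K) (Fin K) ℝ}
    (hO : O ∈ orthogonalGroup (Fin K) ℝ) :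
    O.map (fun a : ℝ => (a : ℂ)) * (O.map (fun a : ℝ => (a : ℂ)))ᵀ = 1 := by
  rw [mem_orthogonalGroup_iff] at hO
  have h := congrArg (fun M : Matrix (Fin K) (Fin K) ℝ => M.map Complex.ofRealHom) hO
  rw [Matrix.map_mul, transpose_map, Matrix.map_one _ (map_zero _) (map_one _)] at h
  exact h

theorem conjTranspose_map_ofReal (O : Matrix (Fin K) (Fin K) ℝ) :
    (O.map (fun a : ℝ => (a : ℂ)))ᴴ = (O.map (fun a : ℝ => (a : ℂ)))ᵀ := by
  ext i j
  exact Complex.conj_ofReal _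

theorem mul_map_mem_fullRank {Z : Matrix (Fin p) (Fin K) ℂ} (hZ : Z ∈ fullRank p K)
    {O : Matrix (Fin K) (Fin K) ℝ} (hO : O ∈ orthogonalGroup (Fin K) ℝ) :
    Z * O.map (fun a : ℝ => (a : ℂ)) ∈ fullRank p K := by
  obtain ⟨L, hL⟩ := mem_fullRank_iff_exists_left_inverse.1 hZ
  refine mem_fullRank_iff_exists_left_inverse.2 ⟨(O.map (fun a : ℝ => (a : ℂ)))ᵀ * L, ?_⟩
  rw [Matrix.mul_assoc, ← Matrix.mul_assoc L, hL, Matrix.one_mul]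
  exact mul_eq_one_comm.1 (map_ofReal_mul_transpose hO)

theorem self_mem_eqClass {Z : Matrix (Fin p) (Fin K) ℂ} (hZ : Z ∈ fullRank p K) :
    Z ∈ eqClass Z := by
  refine ⟨hZ, 1, one_mem _, ?_⟩
  rw [Matrix.map_one _ Complex.ofReal_zero Complex.ofReal_one, Matrix.mul_one]

theorem eqClass_mul_map {Z : Matrix (Fin p) (Fin K) ℂ} {O : Matrix (Fin K) (Fin K) ℝ}
    (hO : O ∈ orthogonalGroup (Fin K) ℝ) :
    eqClass (Z * O.map (fun a : ℝ => (a : ℂ))) = eqClass Z := by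
  have hmap : ∀ U V : Matrix (Fin K) (Fin K) ℝ, (U * V).map (fun a : ℝ => (a : ℂ))
      = U.map (fun a : ℝ => (a : ℂ)) * V.map (fun a : ℝ => (a : ℂ)) := fun U V =>
    Matrix.map_mul (f := Complex.ofRealHom)
  ext W
  constructor
  · rintro ⟨hW, U, hU, rfl⟩
    exact ⟨hW, O * U, mul_mem hO hU, by rw [hmap, Matrix.mul_assoc]⟩
  · rintro ⟨hW, U, hU, rfl⟩
    refine ⟨hW, star O * U, mul_mem (Unitary.star_mem hO) hU, ?_⟩
    rw [Matrix.mul_assoc, ← hmap, ← Matrix.mul_assoc, Unitary.mul_star_self_of_mem hO,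
      Matrix.one_mul]

theorem represents_eqClass {Z : Matrix (Fin p) (Fin K) ℂ} {x : Fin (2 * p - 1) → ℂ}
    (h : hankel x = Z * Zᵀ) (hT : IsToeplitz (Z * Zᴴ)) : Represents (eqClass Z) x := by
  rintro W ⟨-, O, hO, rfl⟩
  have hcancel : ∀ Y : Matrix (Fin K) (Fin p) ℂ, Z * O.map (fun a : ℝ => (a : ℂ)) *
      ((O.map (fun a : ℝ => (a : ℂ)))ᵀ * Y) = Z * Y := fun Y => by
    rw [Matrix.mul_assoc, ← Matrix.mul_assoc (O.map _), map_ofReal_mul_transpose hO,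
      Matrix.one_mul]
  rw [transpose_mul, conjTranspose_mul, conjTranspose_map_ofReal, hcancel, hcancel]
  exact ⟨h, hT⟩

end Classes

/-! ### Existence and uniqueness of the factor for unimodular nodes -/

section Spectrum

variable {p K : ℕ} {x : Fin (2 * p - 1) → ℂ} {z s r : Fin K → ℂ}

theorem powers_mul_diagonal_mem_fullRank (hK : K ≤ p) (hinj : Function.Injective z)
    (hr : ∀ k, r k ≠ 0) : powers p z * diagonal r ∈ fullRank p K := by
  obtain ⟨L, hL⟩ := exists_left_inverse_powers hK hinj
  refine mem_fullRank_iff_exists_left_inverse.2 ⟨diagonal (fun k => (r k)⁻¹) * L, ?_⟩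
  rw [Matrix.mul_assoc, ← Matrix.mul_assoc L, hL, Matrix.one_mul, diagonal_mul_diagonal]
  simp [hr]

theorem represents_powers_mul_diagonal (hz : ∀ k, z k * star (z k) = 1)
    (hx : ∀ n, x n = ∑ k, s k * z k ^ (n : ℕ)) (hr : ∀ k, r k ^ 2 = s k) :
    Represents (eqClass (powers p z * diagonal r)) x := by
  have hgram : ∀ d : Fin K → ℂ, ∀ Y : Matrix (Fin K) (Fin p) ℂ,
      powers p z * diagonal r * (diagonal d * Y)
        = powers p z * diagonal (fun k => r k * d k) * Y := fun d Y => by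
    rw [← diagonal_mul_diagonal]
    simp only [Matrix.mul_assoc]
  apply represents_eqClass
  · rw [transpose_mul, diagonal_transpose, hgram, powers_mul_diagonal_mul_transpose hx]
    rw [show s = fun k => r k * r k from funext fun k => by rw [← hr, sq]]
  · rw [conjTranspose_mul, diagonal_conjTranspose, hgram]
    exact isToeplitz_powers_mul_diagonal hz _

theorem exists_eq_powers_mul_diagonal_mul (hK : K < p) (hinj : Function.Injective z)
    (hz : ∀ k, z k * star (z k) = 1) (hx : ∀ n, x n = ∑ k, s k * z k ^ (n : ℕ))
    (hr : ∀ k, r k ^ 2 = s k) (hr0 : ∀ k, r k ≠ 0) {Z : Matrix (Fin p) (Fin K) ℂ}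
    (hZ : Z ∈ fullRank p K) (hH : hankel x = Z * Zᵀ) (hT : IsToeplitz (Z * Zᴴ)) :
    ∃ O ∈ orthogonalGroup (Fin K) ℝ,
      Z = powers p z * diagonal r * O.map (fun a : ℝ => (a : ℂ)) := by
  obtain ⟨L, hL⟩ := mem_fullRank_iff_exists_left_inverse.1 hZ
  obtain ⟨M, hM⟩ := exists_left_inverse_powers hK.le hinj
  have hMT : (powers p z)ᵀ * Mᵀ = 1 := by rw [← transpose_mul, hM, transpose_one]
  have hLT : Zᵀ * Lᵀ = 1 := by rw [← transpose_mul, hL, transpose_one]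
  rw [powers_mul_diagonal_mul_transpose hx] at hH
  have hri : diagonal (fun k => (r k)⁻¹) * diagonal r = 1 := by simp [diagonal_mul_diagonal, hr0]
  have hri' : diagonal r * diagonal (fun k => (r k)⁻¹) = 1 := mul_eq_one_comm.1 hri
  have hs : diagonal s = diagonal r * diagonal r := by simp [diagonal_mul_diagonal, ← hr, sq]
  obtain ⟨O, hO⟩ : ∃ O, Z = powers p z * (diagonal r * O) := by
    -- Obtained by reading `O` off `Z = Z Zᵀ Lᵀ = H x Lᵀ`.
    refine ⟨diagonal r * ((powers p z)ᵀ * Lᵀ), ?_⟩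
    calc Z = Z * (Zᵀ * Lᵀ) := by rw [hLT, Matrix.mul_one]
      _ = Z * Zᵀ * Lᵀ := by rw [Matrix.mul_assoc]
      _ = _ := by rw [← hH, hs]; simp only [Matrix.mul_assoc]
  have hOT : O * Oᵀ = 1 := by
    have h1 : powers p z * (diagonal r * (O * Oᵀ) * diagonal r) * (powers p z)ᵀ
        = powers p z * diagonal s * (powers p z)ᵀ := by
      rw [hH, hO, transpose_mul, transpose_mul, diagonal_transpose]
      simp only [Matrix.mul_assoc]
    have h2 := eq_of_mul_mul_eq_mul_mul hM hMT h1
    rw [hs] at h2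
    calc O * Oᵀ = (diagonal (fun k => (r k)⁻¹) * diagonal r) * (O * Oᵀ)
          * (diagonal r * diagonal (fun k => (r k)⁻¹)) := by
          rw [hri, hri', Matrix.one_mul, Matrix.mul_one]
      _ = diagonal (fun k => (r k)⁻¹) * (diagonal r * (O * Oᵀ) * diagonal r)
          * diagonal (fun k => (r k)⁻¹) := by simp only [Matrix.mul_assoc]
      _ = (diagonal (fun k => (r k)⁻¹) * diagonal r)
          * (diagonal r * diagonal (fun k => (r k)⁻¹)) := by rw [h2]; simp only [Matrix.mul_assoc]
      _ = 1 := by rw [hri, hri', Matrix.one_mul]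
  have hdiag : ∀ k l, k ≠ l → (O * Oᴴ) k l = 0 := by
    intro k l hkl
    -- The strict inequality `K < p` is needed here: one row is lost to the shift.
    obtain ⟨q, rfl⟩ : ∃ q, p = q + 1 := ⟨p - 1, by omega⟩
    have h1 : Z * Zᴴ = powers (q + 1) z * (diagonal r * (O * Oᴴ) * diagonal (star r))
        * (powers (q + 1) z)ᴴ := by
      rw [hO, conjTranspose_mul, conjTranspose_mul, diagonal_conjTranspose]
      simp only [Matrix.mul_assoc]
    rw [h1] at hT
    have h2 := isDiag_of_isToeplitz (by omega) hinj hz hT hkl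
    rw [mul_diagonal, diagonal_mul, Pi.star_apply] at h2
    simpa [hr0] using h2
  obtain ⟨U, hU, hOU⟩ := exists_real_orthogonal hOT hdiag
  exact ⟨U, hU, by rw [hO, ← hOU, Matrix.mul_assoc]⟩

end Spectrum

/-! ### From frequencies modulo 1 to nodes on the circle -/

/-- The node on the unit circle of a frequency. -/
noncomputable def node (t : ℝ) : ℂ := Complex.exp (2 * Real.pi * Complex.I * t)

theorem exp_eq_node_pow (t : ℝ) (n : ℕ) :
    Complex.exp (2 * Real.pi * Complex.I * (n : ℂ) * (t : ℂ)) = node t ^ n := by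
  rw [node, ← Complex.exp_nat_mul]
  congr 1
  ring

theorem node_eq_toCircle (t : ℝ) : node t = (AddCircle.toCircle (t : UnitAddCircle) : ℂ) := by
  rw [AddCircle.toCircle_apply_mk, Circle.coe_exp, node]
  congr 1
  push_cast
  ring

theorem node_mul_star (t : ℝ) : node t * star (node t) = 1 := by
  rw [node_eq_toCircle]
  refine (Complex.mul_conj' _).trans ?_
  rw [Circle.norm_coe, Complex.ofReal_one, one_pow]

theorem HasSpectrum.node_injective {p K : ℕ} {x : Fin (2 * p - 1) → ℂ} {f : Fin K → ℝ}
    {s : Fin K → ℂ} (hx : HasSpectrum x f s) : Function.Injective fun k => node (f k) := by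
  intro k l h
  by_contra hkl
  refine hx.2.1 k l hkl (AddCircle.injective_toCircle one_ne_zero (Subtype.ext ?_))
  simpa only [node_eq_toCircle] using h

theorem vandermonde_eq_powers (p : ℕ) {K : ℕ} (f : Fin K → ℝ) :
    vandermonde p f = powers p fun k => node (f k) := by
  ext m k
  exact exp_eq_node_pow _ _

end SpectralSparse

/-- Square roots are taken entrywise, with any choice `r k` of a complex square root of `s k`. -/
theorem theorem3p1 (p K : ℕ) (hK : K < p) (x : Fin (2 * p - 1) → ℂ)
    (f : Fin K → ℝ) (s : Fin K → ℂ) (hx : SpectralSparse.HasSpectrum x f s) :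
    (∃! C : Set (Matrix (Fin p) (Fin K) ℂ),
      C ∈ SpectralSparse.quotientSet p K ∧ SpectralSparse.Represents C x) ∧
    ∀ r : Fin K → ℂ, (∀ k, r k ^ 2 = s k) →
      SpectralSparse.vandermonde p f * Matrix.diagonal r ∈ SpectralSparse.fullRank p K ∧
      SpectralSparse.Represents
        (SpectralSparse.eqClass (SpectralSparse.vandermonde p f * Matrix.diagonal r)) x := by
  have hinj := hx.node_injective
  obtain ⟨hs, -, hx⟩ := hx
  simp only [SpectralSparse.exp_eq_node_pow] at hx
  have hz := fun k => SpectralSparse.node_mul_star (f k)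
  have hne : ∀ r : Fin K → ℂ, (∀ k, r k ^ 2 = s k) → ∀ k, r k ≠ 0 := fun r hr k h0 =>
    hs k (by rw [← hr, h0, zero_pow two_ne_zero])
  simp only [SpectralSparse.vandermonde_eq_powers]
  have hrep : ∀ r : Fin K → ℂ, (∀ k, r k ^ 2 = s k) → _ ∧ _ := fun r hr =>
    ⟨SpectralSparse.powers_mul_diagonal_mem_fullRank hK.le hinj (hne r hr),
      SpectralSparse.represents_powers_mul_diagonal hz hx hr⟩
  refine ⟨?_, hrep⟩
  choose r hr using fun k => IsAlgClosed.exists_pow_nat_eq (s k) two_pos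
  refine ⟨_, ⟨⟨_, (hrep r hr).1, rfl⟩, (hrep r hr).2⟩, ?_⟩
  rintro C ⟨⟨Z, hZ, rfl⟩, hC⟩
  obtain ⟨hH, hT⟩ := hC Z (SpectralSparse.self_mem_eqClass hZ)
  obtain ⟨O, hO, rfl⟩ :=
    SpectralSparse.exists_eq_powers_mul_diagonal_mul hK hinj hz hx hr (hne r hr) hZ hH hT
  exact SpectralSparse.eqClass_mul_map hO
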